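/- Let $G_1$ and $G_2$ be finite groups of coprime orders, let $G = G_1 \times G_2$, and for $i = 1,2$ let $M_i$ be a $G_i$-lattice, that is, a $\mathbb{Z}G_i$-module whose underlying abelian group is free of finite rank. Let $M = M_1 \otimes_{\mathbb{Z}} M_2$, regarded as a $G$-module via $(g_1,g_2)(m_1 \otimes m_2) = g_1m_1 \otimes g_2m_2$. For a finite group $H$ and an $H$-module $L$, let $\hat H^n(H,L)$ denote the $n$-th Tate cohomology group of $H$ with coefficients in $L$, and $L^H$ the subgroup of $H$-invariant elements of $L$. Then, for every $n \in \mathbb{Z}$, there is an isomorphism of abelian groups $$\hat H^n(G,M) \;\simeq\; \bigl(\hat H^n(G_1,M_1) \otimes_{\mathbb{Z}} M_2^{G_2}\bigr) \oplus \bigl(M_1^{G_1} \otimes_{\mathbb{Z}} \hat H^n(G_2,M_2)\bigr).$$ -/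

import Mathlib

open CategoryTheory Limits MonoidalCategory

open scoped TensorProduct

/-- A `G`-lattice over `k`: a representation of `G` over `k` whose underlying `k`-module is free of
finite rank. For `k = ℤ` this is a `G`-module whose abelian group is free of finite rank, that is,
a `G`-lattice in the usual sense. -/
structure IsGLattice {k G : Type} [CommRing k] [Group G] (M : Rep.{0} k G) : Prop where
  free : Module.Free k M
  finite : Module.Finite k M

/-- The `G₁ × G₂`-module `M₁ ⊗ M₂` (tensor product over `k`), on which `(g₁, g₂)` acts by
`m₁ ⊗ m₂ ↦ g₁ m₁ ⊗ g₂ m₂`. -/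
noncomputable def externalTensor {k G₁ G₂ : Type} [CommRing k] [Group G₁] [Group G₂]
    (M₁ : Rep.{0} k G₁) (M₂ : Rep.{0} k G₂) : Rep.{0} k (G₁ × G₂) :=
  Rep.of (Representation.tprod
    (M₁.ρ.comp (MonoidHom.fst G₁ G₂)) (M₂.ρ.comp (MonoidHom.snd G₁ G₂)))

/-- The module of invariants `M^G`. -/
noncomputable abbrev invariantsModule {k G : Type} [CommRing k] [Group G] (M : Rep.{0} k G) :
    ModuleCat.{0} k :=
  ModuleCat.of k M.ρ.invariants

theorem externalTensor_apply {k G₁ G₂ : Type} [CommRing k] [Group G₁] [Group G₂]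
    (M₁ : Rep.{0} k G₁) (M₂ : Rep.{0} k G₂) (g₁ : G₁) (g₂ : G₂) (m₁ : M₁) (m₂ : M₂) :
    (externalTensor M₁ M₂).ρ (g₁, g₂) (m₁ ⊗ₜ[k] m₂ : M₁ ⊗[k] M₂) =
      ((M₁.ρ g₁ m₁) ⊗ₜ[k] (M₂.ρ g₂ m₂) : M₁ ⊗[k] M₂) :=
  rfl

-- Write `a`, `b` for the orders of `H`, `K`, with `G = H × K`. Tate cohomology of `G` is killed by
-- `ab`, so by coprimality it is the sum of its `a`-torsion and its `b`-torsion. By symmetry it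
-- suffices that the `a`-torsion of `Ĥⁿ(G, A ⊗ B)` is `Ĥⁿ(H, A) ⊗ B^K`
-- (`nonempty_torsionBy_equiv_tensor`). In degree 0 an explicit map between the two has kernel and
-- cokernel killed by `b²`, hence is an isomorphism on `a`-torsion. Other degrees follow by shifting
-- `A` through the functions `H → A`: these have no Tate cohomology over `H`, and after tensoring
-- with `B` their cohomology over `G` is killed by `b`, invisible to `a`-torsion. All annihilation
-- statements come from one homotopy: if `∑ g, g φ g⁻¹ = c` for a linear `φ`, then `c` kills Tate
-- cohomology (`smul_eq_zero_of_sum_conj`).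

universe u

/-! ### Homology of modules in terms of elements -/

theorem ModuleCat.exists_linearMap_homology {R : Type u} [CommRing R] {A B C : ModuleCat.{u} R}
    (f : A ⟶ B) (g : B ⟶ C) (w : f ≫ g = 0) {P : Type u} [AddCommGroup P] [Module R P]
    (ι : P →ₗ[R] B) (hι : ∀ x, g.hom x = 0 ↔ ∃ p, ι p = x) :
    ∃ π : P →ₗ[R] (ShortComplex.mk f g w).homology, Function.Surjective π ∧
      ∀ p, π p = 0 ↔ ∃ y, f.hom y = ι p := by
  let S := ShortComplex.mk f g w
  let e : S.homology ≃ₗ[R] _ ⧸ LinearMap.range S.moduleCatToCycles :=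
    S.moduleCatHomologyIso.toLinearEquiv
  let ι' : P →ₗ[R] LinearMap.ker S.g.hom :=
    ι.codRestrict _ fun p => LinearMap.mem_ker.2 ((hι _).2 ⟨p, rfl⟩)
  have hι' : Function.Surjective ι' := fun x => by
    obtain ⟨p, hp⟩ := (hι x).1 x.2
    exact ⟨p, Subtype.ext hp⟩
  refine ⟨e.symm.toLinearMap ∘ₗ (LinearMap.range S.moduleCatToCycles).mkQ ∘ₗ ι',
    e.symm.surjective.comp ((Submodule.mkQ_surjective _).comp hι'), fun p => ?_⟩
  rw [LinearMap.comp_apply, LinearEquiv.coe_coe, LinearEquiv.map_eq_zero_iff,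
    LinearMap.comp_apply, Submodule.mkQ_apply, Submodule.Quotient.mk_eq_zero]
  constructor
  · rintro ⟨y, hy⟩
    exact ⟨y, congrArg Subtype.val hy⟩
  · rintro ⟨y, hy⟩
    exact ⟨y, Subtype.ext hy⟩

/-- On a cycle the `h'` term vanishes, so `c • x` is the boundary of `h x`; linearity of `h` plays
no role. -/
theorem ModuleCat.smul_homology_eq_zero {R : Type u} [CommRing R] {A B C : ModuleCat.{u} R}
    (f : A ⟶ B) (g : B ⟶ C) (w : f ≫ g = 0) (c : R) (h : B → A) (h' : C →ₗ[R] B)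
    (hh : ∀ x, f.hom (h x) + h' (g.hom x) = c • x) (z : (ShortComplex.mk f g w).homology) :
    c • z = 0 := by
  obtain ⟨π, hπ, hπ0⟩ := exists_linearMap_homology f g w (LinearMap.ker g.hom).subtype
    (fun x => ⟨fun hx => ⟨⟨x, hx⟩, rfl⟩, by rintro ⟨p, rfl⟩; exact p.2⟩)
  obtain ⟨x, rfl⟩ := hπ z
  rw [← map_smul, hπ0]
  refine ⟨h x, ?_⟩
  have := hh x
  rw [LinearMap.mem_ker.1 x.2, map_zero, add_zero] at this
  simpa using this

/-- The homology of a cochain complex in degree `j` is that of the short complex formed by the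
differentials around `j`. -/
noncomputable def CochainComplex.homologyIsoMk {R : Type u} [CommRing R]
    (K : CochainComplex (ModuleCat.{u} R) ℤ) (i j k : ℤ) (hij : i + 1 = j) (hjk : j + 1 = k) :
    K.homology j ≅ (ShortComplex.mk (K.d i j) (K.d j k) (K.d_comp_d i j k)).homology :=
  ShortComplex.homologyMapIso (K.isoSc' i j k (by simp [← hij]) (by simp [hjk]))

/-! ### Tate cohomology degree by degree -/

namespace TateCohomology

variable {k G : Type u} [CommRing k] [Group G]

open groupCohomology groupHomology

theorem inhomogeneousCochains_d_zero_apply (M : Rep.{u} k G) (x : (Fin 0 → G) → M)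
    (g : Fin 1 → G) : (inhomogeneousCochains.d M 0).hom x g =
      M.ρ (g 0) (x default) - x default := by
  simp [inhomogeneousCochains.d_hom_apply, sub_eq_add_neg, Subsingleton.elim _ (default : Fin 0 → G)]

variable [Fintype G]

/-- Tate cohomology in degree zero, as the homology of `C₀ ⟶ C⁰ ⟶ C¹`. -/
noncomputable def isoZero (M : Rep.{u} k G) : tateCohomology M 0 ≅
    (ShortComplex.mk M.tateNorm ((inhomogeneousCochains M).d 0 1) M.tateNorm_comp_d).homology :=
  (tateComplex M).homologyIsoMk (Int.negSucc 0) (0 : ℕ) (1 : ℕ) rfl rfl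

/-- Tate cohomology in degree `-1`, as the homology of `C₁ ⟶ C₀ ⟶ C⁰`. -/
noncomputable def isoNegOne (M : Rep.{u} k G) : tateCohomology M (-1) ≅
    (ShortComplex.mk ((inhomogeneousChains M).d 1 0) M.tateNorm M.d_comp_tateNorm).homology :=
  (tateComplex M).homologyIsoMk (-2) (-1) 0 rfl rfl

/-- Tate cohomology in positive degrees, as the homology of a piece of the cochain complex. -/
noncomputable def isoPos (M : Rep.{u} k G) (n : ℕ) : tateCohomology M (n + 1 : ℕ) ≅
    (ShortComplex.mk ((inhomogeneousCochains M).d n (n + 1))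
      ((inhomogeneousCochains M).d (n + 1) (n + 2)) (HomologicalComplex.d_comp_d ..)).homology :=
  (tateComplex M).homologyIsoMk n (n + 1 : ℕ) (n + 2 : ℕ) (by simp) (by grind)

/-- Tate cohomology in degrees less than `-1`, as the homology of a piece of the chain complex. -/
noncomputable def isoNeg (M : Rep.{u} k G) (n : ℕ) : tateCohomology M (Int.negSucc (n + 1)) ≅
    (ShortComplex.mk ((inhomogeneousChains M).d (n + 2) (n + 1))
      ((inhomogeneousChains M).d (n + 1) n) (HomologicalComplex.d_comp_d ..)).homology :=
  (tateComplex M).homologyIsoMk (Int.negSucc (n + 2)) (Int.negSucc (n + 1)) (Int.negSucc n)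
    (by grind) (by grind)

/-- Invariants modulo norms, phrased as a surjection with known kernel so that right exactness of
the tensor product applies. -/
theorem exists_linearMap_zero (M : Rep.{u} k G) :
    ∃ π : M.ρ.invariants →ₗ[k] tateCohomology M 0, Function.Surjective π ∧
      ∀ x, π x = 0 ↔ ∃ m, M.ρ.norm m = x := by
  let ι : M.ρ.invariants →ₗ[k] ((Fin 0 → G) → M) :=
    LinearMap.pi fun _ => M.ρ.invariants.subtype
  have key : ∀ x : (Fin 0 → G) → M, (inhomogeneousCochains.d M 0).hom x = 0 ↔ ∃ p, ι p = x := by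
    intro x
    constructor
    · intro h
      refine ⟨⟨x default, fun g => ?_⟩, funext fun i => by
        rw [Subsingleton.elim i default]; rfl⟩
      have := (inhomogeneousCochains_d_zero_apply M x _).symm.trans (congrFun h (fun _ => g))
      exact sub_eq_zero.1 this
    · rintro ⟨p, rfl⟩
      exact funext fun g => (inhomogeneousCochains_d_zero_apply M (ι p) g).trans
        (sub_eq_zero.2 (p.2 _))
  obtain ⟨π, hπ, hπ0⟩ := ModuleCat.exists_linearMap_homology M.tateNorm
    ((inhomogeneousCochains M).d 0 1) M.tateNorm_comp_d ι (by
      rw [groupCohomology.inhomogeneousCochains.d_def]; exact key)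
  let e := (isoZero M).toLinearEquiv.symm
  refine ⟨e.toLinearMap ∘ₗ π, e.surjective.comp hπ, fun x => ?_⟩
  rw [LinearMap.comp_apply, LinearEquiv.coe_coe, LinearEquiv.map_eq_zero_iff, hπ0,
    Rep.tateNorm_eq]
  constructor
  · rintro ⟨y, hy⟩
    refine ⟨y default, ?_⟩
    have : y = Finsupp.single default (y default) := by
      refine Finsupp.ext fun i => ?_
      rw [Subsingleton.elim i default]; exact (Finsupp.single_eq_same ..).symm
    rw [this] at hy
    have := congrFun hy default
    simp only [ModuleCat.hom_ofHom, Finsupp.lsum_single] at this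
    exact this
  · rintro ⟨m, hm⟩
    refine ⟨Finsupp.single default m, ?_⟩
    funext i
    simp only [ModuleCat.hom_ofHom, Finsupp.lsum_single]
    exact hm

end TateCohomology

/-! ### The homotopy attached to a linear endomorphism -/

theorem Fin.contractNth_zero_cons {α : Type*} (op : α → α → α) {n : ℕ} (a : α)
    (x : Fin (n + 1) → α) :
    Fin.contractNth 0 op (Fin.cons a x : Fin (n + 2) → α) =
      Fin.cons (op a (x 0)) fun i => x i.succ := by
  funext i
  cases i using Fin.cases with
  | zero => simp [Fin.contractNth]
  | succ i => simp [Fin.contractNth]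

theorem Fin.contractNth_succ_cons {α : Type*} (op : α → α → α) {n : ℕ} (j : Fin (n + 1)) (a : α)
    (x : Fin (n + 1) → α) :
    Fin.contractNth j.succ op (Fin.cons a x : Fin (n + 2) → α) =
      Fin.cons a (Fin.contractNth j op x) := by
  funext i
  cases i using Fin.cases with
  | zero => simp [Fin.contractNth]
  | succ i => simp [Fin.contractNth]

namespace TateCohomology

variable {k G : Type u} [CommRing k] [Group G] [Fintype G] (M : Rep.{u} k G) (φ : M →ₗ[k] M)

open groupCohomology groupHomology

/-- The homotopy on inhomogeneous cochains attached to a linear endomorphism `φ`, which has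
boundary `∑ g, g φ g⁻¹`. -/
def cochainHomotopy (n : ℕ) : ((Fin (n + 1) → G) → M) →ₗ[k] ((Fin n → G) → M) :=
  LinearMap.pi fun x => ∑ g : G, M.ρ g ∘ₗ φ ∘ₗ LinearMap.proj (Fin.cons g⁻¹ x)

/-- The homotopy on inhomogeneous chains attached to a linear endomorphism `φ`, which has
boundary `∑ g, g φ g⁻¹`. -/
noncomputable def chainHomotopy (n : ℕ) : ((Fin n → G) →₀ M) →ₗ[k] ((Fin (n + 1) → G) →₀ M) :=
  Finsupp.lsum k fun x => ∑ g : G, Finsupp.lsingle (Fin.cons g x) ∘ₗ φ ∘ₗ M.ρ g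

@[simp]
theorem cochainHomotopy_apply (n : ℕ) (f : (Fin (n + 1) → G) → M) (x : Fin n → G) :
    cochainHomotopy M φ n f x = ∑ g : G, M.ρ g (φ (f (Fin.cons g⁻¹ x))) := by
  simp [cochainHomotopy]

@[simp]
theorem chainHomotopy_single (n : ℕ) (x : Fin n → G) (a : M) :
    chainHomotopy M φ n (Finsupp.single x a) =
      ∑ g : G, Finsupp.single (Fin.cons g x) (φ (M.ρ g a)) := by
  simp [chainHomotopy]

/-- In `h (d f)` the leading term gives the conjugates of `φ`. The contraction of `g⁻¹` with `x 0`
cancels the leading term of `d (h f)` after translating `g` by `x 0`; the other contractions cancel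
in pairs, their signs shifted by one. -/
theorem d_cochainHomotopy_add (n : ℕ) (f : (Fin (n + 1) → G) → M) (x : Fin (n + 1) → G) :
    (inhomogeneousCochains.d M n).hom (cochainHomotopy M φ n f) x +
      cochainHomotopy M φ (n + 1) ((inhomogeneousCochains.d M (n + 1)).hom f) x =
        ∑ g : G, M.ρ g (φ (M.ρ g⁻¹ (f x))) := by
  have h0 : M.ρ (x 0) (∑ g : G, M.ρ g (φ (f (Fin.cons g⁻¹ fun i => x i.succ)))) =
      ∑ g : G, M.ρ g (φ (f (Fin.cons (g⁻¹ * x 0) fun i => x i.succ))) := by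
    rw [map_sum]
    refine Fintype.sum_equiv (Equiv.mulLeft (x 0)) _ _ fun g => ?_
    simp [map_mul]
  simp only [inhomogeneousCochains.d_hom_apply, cochainHomotopy_apply, h0]
  simp only [map_add, map_sum, map_smul, Finset.sum_add_distrib]
  rw [Finset.sum_comm (s := (Finset.univ : Finset G))]
  simp only [Fin.sum_univ_succ (n := n + 1), Fin.contractNth_zero_cons,
    Fin.contractNth_succ_cons, ← Finset.smul_sum, Fin.cons_zero, Fin.cons_succ, Fin.val_succ,
    Fin.val_zero]
  simp only [pow_succ _ (_ + 1), mul_neg, mul_one, neg_smul, Finset.sum_neg_distrib, zero_add,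
    pow_one, one_smul]
  abel

theorem d_chainHomotopy_add (c : k) (hφ : ∀ m, ∑ g : G, M.ρ g (φ (M.ρ g⁻¹ m)) = c • m)
    (n : ℕ) (y : (Fin (n + 1) → G) →₀ M) :
    (inhomogeneousChains.d M (n + 1)).hom (chainHomotopy M φ (n + 1) y) +
      chainHomotopy M φ n ((inhomogeneousChains.d M n).hom y) = c • y := by
  induction y using Finsupp.induction_linear with
  | zero => simp
  | add y z hy hz => rw [map_add, map_add, map_add, map_add, smul_add, ← hy, ← hz]; abel
  | single x a =>
    have h0 : ∑ g : G, Finsupp.single (Fin.cons g fun i => x i.succ) (φ (M.ρ g (M.ρ (x 0)⁻¹ a))) =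
        ∑ g : G, Finsupp.single (Fin.cons (g * x 0) fun i => x i.succ : Fin (n + 1) → G)
          (φ (M.ρ g a)) := by
      refine Fintype.sum_equiv (Equiv.mulRight (x 0)⁻¹) _ _ fun g => ?_
      simp [map_mul]
    have h1 : ∑ g : G, Finsupp.single x (M.ρ g⁻¹ (φ (M.ρ g a))) = c • Finsupp.single x a := by
      rw [Finsupp.smul_single, ← hφ a]
      refine Eq.trans ?_ (map_sum (Finsupp.singleAddHom x) _ _).symm
      exact Fintype.sum_equiv (Equiv.inv G) _ _ fun g => by simp
    have hd : ∀ (n : ℕ) (x : Fin (n + 1) → G) (a : M),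
        (inhomogeneousChains.d M n).hom (Finsupp.single x a) =
          Finsupp.single (fun i => x i.succ) (M.ρ (x 0)⁻¹ a) + ∑ j : Fin (n + 1),
            (-1 : k) ^ ((j : ℕ) + 1) • Finsupp.single (Fin.contractNth j (· * ·) x) a :=
      fun n x a => inhomogeneousChains.d_single n x a
    rw [chainHomotopy_single, map_sum, hd, map_add, map_sum, chainHomotopy_single, h0]
    simp only [hd, map_smul, chainHomotopy_single, Finset.sum_add_distrib, Fin.cons_zero,
      Fin.cons_succ, h1]
    rw [Finset.sum_comm (s := (Finset.univ : Finset G))]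
    simp only [Fin.sum_univ_succ (n := n + 1), Fin.contractNth_zero_cons,
      Fin.contractNth_succ_cons, ← Finset.smul_sum, Fin.val_succ, Fin.val_zero]
    simp only [pow_succ _ (_ + 1), mul_neg, mul_one, neg_smul, Finset.sum_neg_distrib, zero_add,
      pow_one, one_smul]
    abel

/-- At the junction of chains and cochains the norm replaces the differential, and the homotopy `C⁰
→ C₀` is `φ` itself. -/
theorem norm_add_cochainHomotopy_d (x : (Fin 0 → G) → M) :
    M.ρ.norm (φ (x default)) +
      cochainHomotopy M φ 0 ((inhomogeneousCochains.d M 0).hom x) default =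
        ∑ g : G, M.ρ g (φ (M.ρ g⁻¹ (x default))) := by
  have h : ∀ i, (inhomogeneousCochains.d M 0).hom x i = M.ρ (i 0) (x default) - x default :=
    inhomogeneousCochains_d_zero_apply M x
  simp [h, Representation.norm]

theorem d_chainHomotopy_add_norm (c : k) (hφ : ∀ m, ∑ g : G, M.ρ g (φ (M.ρ g⁻¹ m)) = c • m)
    (y : (Fin 0 → G) →₀ M) :
    (inhomogeneousChains.d M 0).hom (chainHomotopy M φ 0 y) +
      Finsupp.single default (φ (M.ρ.norm (y default))) = c • y := by
  have hd : ∀ (x : Fin 1 → G) (a : M), (inhomogeneousChains.d M 0).hom (Finsupp.single x a) =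
      Finsupp.single default (M.ρ (x 0)⁻¹ a) - Finsupp.single default a := fun x a => by
    refine (inhomogeneousChains.d_single 0 x a).trans ?_
    simp [sub_eq_add_neg, Subsingleton.elim _ (default : Fin 0 → G)]
  have h1 : ∀ a, ∑ g : G, Finsupp.single default (M.ρ g⁻¹ (φ (M.ρ g a))) =
      c • Finsupp.single (default : Fin 0 → G) a := fun a => by
    rw [Finsupp.smul_single, ← hφ a]
    refine Eq.trans ?_ (map_sum (Finsupp.singleAddHom default) _ _).symm
    exact Fintype.sum_equiv (Equiv.inv G) _ _ fun g => by simp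
  obtain ⟨a, rfl⟩ : ∃ a, y = Finsupp.single default a :=
    ⟨y default, Finsupp.ext fun i => by
      rw [Subsingleton.elim i default]; exact (Finsupp.single_eq_same ..).symm⟩
  rw [chainHomotopy_single, map_sum]
  simp only [hd, Finset.sum_sub_distrib, Fin.cons_zero, h1, Finsupp.single_eq_same]
  rw [Representation.norm, LinearMap.sum_apply, map_sum, Finsupp.single_finsetSum,
    sub_add_cancel]

theorem smul_eq_zero_of_sum_conj (c : k)
    (hφ : ∀ m, ∑ g : G, M.ρ g (φ (M.ρ g⁻¹ m)) = c • m) (n : ℤ) (z : tateCohomology M n) :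
    c • z = 0 := by
  -- The cases are the degrees `0`, `n + 1`, `-1` and `-(n + 2)`.
  obtain (_ | n) | (_ | n) := n
  · let e := (isoZero M).toLinearEquiv
    refine e.injective ((map_smul e c z).trans (Eq.trans ?_ (map_zero e).symm))
    refine ModuleCat.smul_homology_eq_zero _ _ _ c
      (fun x : (Fin 0 → G) → M => Finsupp.single default (φ (x default)))
      (cochainHomotopy M φ 0) (fun x => ?_) (e z)
    rw [Rep.tateNorm_eq, groupCohomology.inhomogeneousCochains.d_def]
    funext i
    rw [Subsingleton.elim i default]
    simp only [ModuleCat.hom_ofHom, Finsupp.lsum_single]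
    exact (norm_add_cochainHomotopy_d M φ x).trans (hφ _)
  · let e := (isoPos M n).toLinearEquiv
    refine e.injective ((map_smul e c z).trans (Eq.trans ?_ (map_zero e).symm))
    refine ModuleCat.smul_homology_eq_zero _ _ _ c (cochainHomotopy M φ n)
      (cochainHomotopy M φ (n + 1)) (fun x => ?_) (e z)
    rw [groupCohomology.inhomogeneousCochains.d_def, groupCohomology.inhomogeneousCochains.d_def]
    funext i
    exact (d_cochainHomotopy_add M φ n x i).trans (hφ _)
  · let e := (isoNegOne M).toLinearEquiv
    refine e.injective ((map_smul e c z).trans (Eq.trans ?_ (map_zero e).symm))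
    refine ModuleCat.smul_homology_eq_zero _ _ _ c (chainHomotopy M φ 0)
      (Finsupp.lsingle (default : Fin 0 → G) ∘ₗ φ ∘ₗ
        (LinearMap.proj default : ((Fin 0 → G) → M) →ₗ[k] M)) (fun x => ?_) (e z)
    have hN : Finsupp.lsum k (fun _ : Fin 0 → G => LinearMap.pi fun _ : Fin 0 → G => M.ρ.norm) x
        default = M.ρ.norm (x default) := by
      obtain ⟨a, rfl⟩ : ∃ a, x = Finsupp.single default a :=
        ⟨x default, Finsupp.ext fun i => by
          rw [Subsingleton.elim i default]; exact (Finsupp.single_eq_same ..).symm⟩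
      simp
    rw [Rep.tateNorm_eq, groupHomology.inhomogeneousChains.d_def]
    refine Eq.trans ?_ (d_chainHomotopy_add_norm M φ c hφ x)
    rw [← hN]
    rfl
  · let e := (isoNeg M n).toLinearEquiv
    refine e.injective ((map_smul e c z).trans (Eq.trans ?_ (map_zero e).symm))
    refine ModuleCat.smul_homology_eq_zero _ _ _ c (chainHomotopy M φ (n + 1))
      (chainHomotopy M φ n) (fun x => ?_) (e z)
    rw [groupHomology.inhomogeneousChains.d_def, groupHomology.inhomogeneousChains.d_def]
    exact d_chainHomotopy_add M φ c hφ n x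

end TateCohomology

/-! ### Torsion comparison and connecting maps -/

/-- Let `f : Y → Z` have kernel and cokernel killed by `b`, where `a` and `b` are coprime and `a * b`
kills `Y`. Then `f` is an isomorphism on `a`-torsion. -/
theorem Submodule.nonempty_torsionBy_equiv {R Y Z : Type*} [CommRing R] [AddCommGroup Y]
    [Module R Y] [AddCommGroup Z] [Module R Z] {a b : R} (hab : IsCoprime a b) (f : Y →ₗ[R] Z)
    (hY : ∀ y : Y, (a * b) • y = 0) (hker : ∀ y, f y = 0 → b • y = 0)
    (hcoker : ∀ z, ∃ y, f y = b • z) :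
    Nonempty (torsionBy R Y a ≃ₗ[R] torsionBy R Z a) := by
  obtain ⟨u, v, huv⟩ := hab
  have hY' : ∀ y : Y, a • y = 0 → (v * b) • y = y := fun y hy => by
    conv_rhs => rw [← one_smul R y, ← huv, add_smul, mul_smul u, hy, smul_zero, zero_add]
  have hZ' : ∀ z : Z, a • z = 0 → (v * b) • z = z := fun z hz => by
    conv_rhs => rw [← one_smul R z, ← huv, add_smul, mul_smul u, hz, smul_zero, zero_add]
  have hf : ∀ y ∈ torsionBy R Y a, f y ∈ torsionBy R Z a := fun y hy => by
    rw [mem_torsionBy_iff] at hy ⊢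
    rw [← map_smul, hy, map_zero]
  refine ⟨LinearEquiv.ofBijective (f.restrict hf) ⟨?_, ?_⟩⟩
  · rw [← LinearMap.ker_eq_bot, LinearMap.ker_eq_bot']
    intro y hy
    have h1 : b • (y : Y) = 0 := hker y (congrArg Subtype.val hy)
    apply Subtype.ext
    rw [← hY' (y : Y) ((mem_torsionBy_iff _ _).1 y.2), mul_smul, h1, smul_zero]
    rfl
  · intro z
    obtain ⟨y, hy⟩ := hcoker z
    -- `v • y` already maps to `z`; the extra factor `v * b` moves it into the `a`-torsion and fixes
    -- `z`.
    refine ⟨⟨(v * b * v) • y, ?_⟩, Subtype.ext ?_⟩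
    · rw [mem_torsionBy_iff, smul_smul, show a * (v * b * v) = v * v * (a * b) by ring, mul_smul,
        hY, smul_zero]
    · have hz := hZ' (z : Z) ((mem_torsionBy_iff _ _).1 z.2)
      change f ((v * b * v) • y) = z
      rw [map_smul, hy, smul_smul, mul_assoc _ v b, mul_smul, hz, hz]

theorem Rep.shortExact_of_function_exact {k G : Type u} [CommRing k] [Group G]
    {A B C : Rep.{u} k G} (f : A ⟶ B) (g : B ⟶ C)
    (hf : Function.Injective f.hom) (hfg : Function.Exact f.hom g.hom)
    (hg : Function.Surjective g.hom) :
    (ShortComplex.mk f g (by ext x; exact hfg.apply_apply_eq_zero x)).ShortExact := by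
  have h : ((ShortComplex.mk f g (by ext x; exact hfg.apply_apply_eq_zero x)).map
      (forget₂ (Rep k G) (ModuleCat k))).ShortExact :=
    { exact := (ShortComplex.moduleCat_exact_iff _).2 fun x hx => (hfg x).1 hx
      mono_f := (ModuleCat.mono_iff_injective _).2 hf
      epi_g := (ModuleCat.epi_iff_surjective _).2 hg }
  exact ShortExact.reflects_shortExact_of_faithful (forget₂ (Rep k G) (ModuleCat k)) h

namespace TateCohomology

variable {k G : Type u} [CommRing k] [Group G] [Fintype G]

/-- In the long exact sequence the kernel and cokernel of `δ` are controlled by the cohomology of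
`B`. -/
theorem exists_linearMap_succ {A B C : Rep.{u} k G} (f : A ⟶ B) (g : B ⟶ C)
    (hf : Function.Injective f.hom) (hfg : Function.Exact f.hom g.hom)
    (hg : Function.Surjective g.hom) (c : k)
    (hc : ∀ n (z : tateCohomology B n), c • z = 0) (n : ℤ) :
    ∃ δ : tateCohomology C n →ₗ[k] tateCohomology A (n + 1),
      (∀ y, δ y = 0 → c • y = 0) ∧ ∀ z, ∃ y, δ y = c • z := by
  have hS := Rep.shortExact_of_function_exact f g hf hfg hg
  refine ⟨(TateCohomology.δ hS n).hom, fun y hy => ?_, fun z => ?_⟩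
  · obtain ⟨x, hx⟩ := (ShortComplex.moduleCat_exact_iff _).1 (TateCohomology.exact₃ hS n) y hy
    refine (congrArg (c • ·) hx.symm).trans ?_
    exact (map_smul _ c x).symm.trans ((congrArg _ (hc n x)).trans (map_zero _))
  · obtain ⟨x, hx⟩ := (ShortComplex.moduleCat_exact_iff _).1 (TateCohomology.exact₁ hS n)
      (c • z) ((map_smul _ c z).trans (hc (n + 1) _))
    exact ⟨x, hx⟩

theorem nonempty_equiv_succ {A B C : Rep.{u} k G} (f : A ⟶ B) (g : B ⟶ C)
    (hf : Function.Injective f.hom) (hfg : Function.Exact f.hom g.hom)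
    (hg : Function.Surjective g.hom) (hB : ∀ n (z : tateCohomology B n), z = 0) (n : ℤ) :
    Nonempty (tateCohomology C n ≃ₗ[k] tateCohomology A (n + 1)) := by
  obtain ⟨δ, h1, h2⟩ := exists_linearMap_succ f g hf hfg hg 1 (fun n z => by simp [hB n z]) n
  refine ⟨LinearEquiv.ofBijective δ ⟨?_, fun z => ?_⟩⟩
  · rw [← LinearMap.ker_eq_bot, LinearMap.ker_eq_bot']
    simpa using h1
  · simpa using h2 z

theorem card_smul_eq_zero (M : Rep.{u} k G) (n : ℤ) (z : tateCohomology M n) :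
    (Fintype.card G : k) • z = 0 :=
  smul_eq_zero_of_sum_conj M LinearMap.id _ (by simp [Nat.cast_smul_eq_nsmul]) n z

end TateCohomology

/-! ### Function modules and tensor products -/

namespace Rep

variable {k G H K : Type u} [CommRing k] [Group G] [Group H] [Group K]

theorem function_exact_of_shortExact {S : ShortComplex (Rep.{u} k H)} (hS : S.ShortExact) :
    Function.Injective S.f.hom ∧ Function.Exact S.f.hom S.g.hom ∧
      Function.Surjective S.g.hom := by
  have h := hS.map_of_exact (forget₂ (Rep k H) (ModuleCat k))
  exact ⟨h.moduleCat_injective_f,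
    (ShortComplex.ShortExact.moduleCat_exact_iff_function_exact _).1 h.exact,
    h.moduleCat_surjective_g⟩

/-- The functions `H → V`, on which `g : H` acts by `f ↦ (x ↦ g (f (g⁻¹ x)))`. -/
def _root_.Representation.funRep {V : Type*} [AddCommGroup V] [Module k V]
    (ρ : Representation k H V) : Representation k H (H → V) where
  toFun g := LinearMap.pi fun x => ρ g ∘ₗ LinearMap.proj (g⁻¹ * x)
  map_one' := by ext; simp
  map_mul' g h := by ext; simp [mul_assoc]

@[simp]
theorem _root_.Representation.funRep_apply {V : Type*} [AddCommGroup V] [Module k V]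
    (ρ : Representation k H V) (g : H) (f : H → V) (x : H) :
    ρ.funRep g f x = ρ g (f (g⁻¹ * x)) :=
  rfl

/-- The functions `H → M`, on which `g : H` acts by `f ↦ (x ↦ g (f (g⁻¹ x)))`. -/
abbrev funRep (M : Rep.{u} k H) : Rep.{u} k H :=
  Rep.of M.ρ.funRep

/-- The embedding of `M` into the functions `H → M` as the constant functions. -/
noncomputable def funRepConst (M : Rep.{u} k H) : M ⟶ funRep M :=
  Rep.ofHom ⟨LinearMap.pi fun _ => LinearMap.id, fun _ => rfl⟩

/-- The map from functions `H → M` to `M` which sums the values. -/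
noncomputable def funRepSum [Fintype H] (M : Rep.{u} k H) : funRep M ⟶ M :=
  Rep.ofHom ⟨∑ x : H, LinearMap.proj x, fun g => LinearMap.ext fun f => by
    simp only [LinearMap.comp_apply, LinearMap.sum_apply, LinearMap.proj_apply, map_sum]
    exact Fintype.sum_equiv (Equiv.mulLeft g⁻¹) _ _ fun x => rfl⟩

theorem mono_funRepConst (M : Rep.{u} k H) : Mono (funRepConst M) :=
  (Rep.mono_iff_injective _).2 fun _ _ h => congrFun h 1

theorem epi_funRepSum [Fintype H] (M : Rep.{u} k H) : Epi (funRepSum M) := by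
  classical
  refine (Rep.epi_iff_surjective _).2 fun x => ⟨(Pi.single 1 x : H → M), ?_⟩
  change (∑ x : H, LinearMap.proj x : (H → M) →ₗ[k] M) _ = x
  simp

/-- The `G`-module `A ⊗ B`, where `G` acts on `A` through `p` and on `B` through `q`. -/
noncomputable abbrev tensorRes (p : G →* H) (q : G →* K) (A : Rep.{u} k H) (B : Rep.{u} k K) :
    Rep.{u} k G :=
  Rep.of (Representation.tprod (A.ρ.comp p) (B.ρ.comp q))

theorem tensorRes_ρ (p : G →* H) (q : G →* K) (A : Rep.{u} k H) (B : Rep.{u} k K) (g : G) :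
    (tensorRes p q A B).ρ g = TensorProduct.map (A.ρ (p g)) (B.ρ (q g)) :=
  rfl

/-- Functoriality of `tensorRes` in the first module. -/
noncomputable def tensorResMap (p : G →* H) (q : G →* K) {A A' : Rep.{u} k H} (f : A ⟶ A')
    (B : Rep.{u} k K) : tensorRes p q A B ⟶ tensorRes p q A' B :=
  Rep.ofHom ⟨f.hom.toLinearMap.rTensor B, fun g => TensorProduct.ext' fun x y => by
    simp [Rep.hom_comm_apply]⟩

end Rep

namespace TateCohomology

variable {k G H K : Type u} [CommRing k] [Group G] [Group H] [Group K]
  [Fintype G] [Fintype H] [Fintype K]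

open Rep

/-- Take `φ` to keep only the value at `1`: its conjugate by `g` keeps only the value at `g`, and
these sum to the identity. -/
theorem eq_zero_funRep (M : Rep.{u} k H) (n : ℤ) (z : tateCohomology (funRep M) n) : z = 0 := by
  classical
  rw [← one_smul k z]
  refine smul_eq_zero_of_sum_conj (funRep M)
    (LinearMap.single k (fun _ => M) 1 ∘ₗ LinearMap.proj 1) 1 (fun f : H → M => ?_) n z
  rw [one_smul]
  funext x
  rw [Finset.sum_apply]
  have : ∀ g : H, M.ρ g (Pi.single (M := fun _ => M) 1 (M.ρ g⁻¹ (f g)) (g⁻¹ * x)) =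
      if g = x then f g else 0 := fun g => by
    split_ifs with h <;> simp [inv_mul_eq_one, h]
  simp [this]

/-- The conjugate of `φ ⊗ id` by `g` depends only on `p g`, and each element of `H` is `p g` for
`|K|` elements `g`. -/
theorem card_smul_eq_zero_tensorRes_funRep {p : G →* H} {q : G →* K}
    (hpq : Function.Bijective (p.prod q)) (A : Rep.{u} k H) (B : Rep.{u} k K) (n : ℤ)
    (z : tateCohomology (tensorRes p q (funRep A) B) n) : (Fintype.card K : k) • z = 0 := by
  classical
  let φ : (H → A) →ₗ[k] (H → A) := LinearMap.single k (fun _ => A) 1 ∘ₗ LinearMap.proj 1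
  let ρ : Representation k G ((H → A) ⊗[k] B) := (tensorRes p q (funRep A) B).ρ
  have key : ∑ g : G, ρ g ∘ₗ φ.rTensor B ∘ₗ ρ g⁻¹ = (Fintype.card K : k) • LinearMap.id := by
    refine TensorProduct.ext' fun f y => ?_
    have h : ∀ g : G, (ρ g ∘ₗ φ.rTensor B ∘ₗ ρ g⁻¹) (f ⊗ₜ y) =
        (Pi.single (p g) (f (p g)) : H → A) ⊗ₜ[k] y := by
      intro g
      change ((funRep A).ρ (p g) (φ ((funRep A).ρ (p g⁻¹) f)) : H → A) ⊗ₜ[k]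
        (B.ρ (q g) (B.ρ (q g⁻¹) y)) = _
      congr 1
      · funext x
        by_cases hx : p g = x
        · subst hx; simp [φ]
        · simp [φ, inv_mul_eq_one, hx]
      · simp
    rw [LinearMap.sum_apply, Finset.sum_congr rfl fun g _ => h g]
    have hp : ∀ c, p ((Equiv.ofBijective _ hpq).symm c) = c.1 := fun c =>
      congrArg Prod.fst ((Equiv.ofBijective _ hpq).apply_symm_apply c)
    rw [← (Equiv.ofBijective _ hpq).symm.sum_comp, Fintype.sum_prod_type]
    simp only [hp, Finset.sum_const, Finset.card_univ, ← Finset.smul_sum]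
    rw [← TensorProduct.sum_tmul, Finset.univ_sum_single, LinearMap.smul_apply,
      Nat.cast_smul_eq_nsmul]
    rfl
  refine smul_eq_zero_of_sum_conj (tensorRes p q (funRep A) B) (φ.rTensor B) _ (fun m => ?_) n z
  have := LinearMap.congr_fun key m
  rw [LinearMap.sum_apply] at this
  exact this

end TateCohomology

/-! ### Invariants, norms and degree zero -/

namespace Representation

variable {k H V : Type*} [CommRing k] [Group H] [Finite H] [AddCommGroup V] [Module k V]

/-- The invariants are the kernel of `v ↦ (h v - v)_h`, and flat base change preserves kernels. -/
theorem mem_range_rTensor_invariants (ρ : Representation k H V) (Q : Type*) [AddCommGroup Q]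
    [Module k Q] [Module.Flat k Q] (z : V ⊗[k] Q) (hz : ∀ h, (ρ h).rTensor Q z = z) :
    ∃ w : ρ.invariants ⊗[k] Q, ρ.invariants.subtype.rTensor Q w = z := by
  classical
  have := Fintype.ofFinite H
  let F : V →ₗ[k] (H → V) := LinearMap.pi fun h => ρ h - LinearMap.id
  have hF : F = ∑ h, LinearMap.single k (fun _ => V) h ∘ₗ (ρ h - LinearMap.id) := by
    refine LinearMap.ext fun v => funext fun h => ?_
    simp [F, LinearMap.sum_apply, Finset.sum_apply, Pi.single_apply]
  have hex : Function.Exact ρ.invariants.subtype F := fun v => by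
    constructor
    · intro h
      exact ⟨⟨v, fun g => sub_eq_zero.1 (congrFun h g)⟩, rfl⟩
    · rintro ⟨w, rfl⟩
      exact funext fun g => sub_eq_zero.2 (w.2 g)
  refine (Module.Flat.rTensor_exact Q hex z).1 ?_
  have hsum : F.rTensor Q = ∑ h, (LinearMap.single k (fun _ => V) h).rTensor Q ∘ₗ
      ((ρ h).rTensor Q - LinearMap.id) := by
    rw [hF]
    refine TensorProduct.ext' fun v y => ?_
    simp only [LinearMap.sum_apply, LinearMap.rTensor_tmul, LinearMap.comp_apply,
      LinearMap.sub_apply, LinearMap.id_apply, TensorProduct.sum_tmul, map_sub,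
      TensorProduct.sub_tmul]
  rw [hsum, LinearMap.sum_apply]
  exact Finset.sum_eq_zero fun h _ => by simp [hz h]

end Representation

namespace Rep

variable {k G H K : Type u} [CommRing k] [Group G] [Group H] [Group K]

theorem rTensor_eq_of_mem_invariants {p : G →* H} {q : G →* K}
    (hpq : Function.Surjective (p.prod q)) (A : Rep.{u} k H) (B : Rep.{u} k K)
    {t : A ⊗[k] B} (ht : t ∈ (tensorRes p q A B).ρ.invariants) (h : H) :
    (A.ρ h).rTensor B t = t := by
  obtain ⟨g, hg⟩ := hpq (h, 1)
  obtain ⟨rfl, hg⟩ := Prod.ext_iff.1 hg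
  have := ht g
  rw [tensorRes_ρ, show q g = 1 from hg, map_one] at this
  exact this

theorem lTensor_eq_of_mem_invariants {p : G →* H} {q : G →* K}
    (hpq : Function.Surjective (p.prod q)) (A : Rep.{u} k H) (B : Rep.{u} k K)
    {t : A ⊗[k] B} (ht : t ∈ (tensorRes p q A B).ρ.invariants) (h : K) :
    (B.ρ h).lTensor A t = t := by
  obtain ⟨g, hg⟩ := hpq (1, h)
  obtain ⟨hg, rfl⟩ := Prod.ext_iff.1 hg
  have := ht g
  rw [tensorRes_ρ, show p g = 1 from hg, map_one] at this
  exact this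

end Rep

namespace TateCohomology

variable {k G H K : Type u} [CommRing k] [Group G] [Group H] [Group K]
  [Fintype G] [Fintype H] [Fintype K]

open Rep

theorem norm_tensorRes {p : G →* H} {q : G →* K} (hpq : Function.Bijective (p.prod q))
    (A : Rep.{u} k H) (B : Rep.{u} k K) :
    (tensorRes p q A B).ρ.norm = TensorProduct.map A.ρ.norm B.ρ.norm := by
  refine TensorProduct.ext' fun x y => ?_
  have h : ∀ c, (tensorRes p q A B).ρ ((Equiv.ofBijective _ hpq).symm c) (x ⊗ₜ y) =
      A.ρ c.1 x ⊗ₜ[k] B.ρ c.2 y := fun c => by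
    have := (Equiv.ofBijective _ hpq).apply_symm_apply c
    rw [Equiv.ofBijective_apply] at this
    conv_rhs => rw [← this]
    rfl
  rw [Representation.norm, LinearMap.sum_apply, ← (Equiv.ofBijective _ hpq).symm.sum_comp,
    Fintype.sum_prod_type]
  simp only [h]
  rw [TensorProduct.map_tmul, Representation.norm, Representation.norm, LinearMap.sum_apply,
    LinearMap.sum_apply, TensorProduct.sum_tmul]
  simp only [TensorProduct.tmul_sum]

/-- The norm of a representation, as a map to its invariants. -/
noncomputable def normToInvariants (A : Rep.{u} k H) : A →ₗ[k] A.ρ.invariants :=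
  A.ρ.norm.codRestrict _ fun x g => by simp

theorem norm_apply_of_mem_invariants (A : Rep.{u} k H) (x : A.ρ.invariants) :
    A.ρ.norm (x : A) = (Fintype.card H : k) • (x : A) := by
  rw [Representation.norm, LinearMap.sum_apply, Finset.sum_congr rfl fun g _ => x.2 g]
  simp [Nat.cast_smul_eq_nsmul]

/-- In degree zero, `Ĥ⁰(H, A) ⊗ B^K` maps to `Ĥ⁰(G, A ⊗ B)` with kernel and cokernel killed by
the square of the order of `K`. -/
theorem exists_linearMap_tensor_zero {p : G →* H} {q : G →* K}
    (hpq : Function.Bijective (p.prod q)) (A : Rep.{u} k H) (B : Rep.{u} k K)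
    [Module.Flat k B.ρ.invariants] :
    ∃ F : tateCohomology A 0 ⊗[k] B.ρ.invariants →ₗ[k] tateCohomology (tensorRes p q A B) 0,
      (∀ y, F y = 0 → (Fintype.card K : k) ^ 2 • y = 0) ∧
        ∀ z, ∃ y, F y = (Fintype.card K : k) ^ 2 • z := by
  obtain ⟨π, hπ, hπ0⟩ := exists_linearMap_zero A
  obtain ⟨τ, hτ, hτ0⟩ := exists_linearMap_zero (tensorRes p q A B)
  let b : k := Fintype.card K
  let Q := B.ρ.invariants
  let P := A.ρ.invariants
  let M := tensorRes p q A B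
  let N₁ := normToInvariants A
  -- `r`, the norm of `K` on the second factor, is the inverse of `i₀` up to powers of `b`.
  let r : A ⊗[k] B →ₗ[k] A ⊗[k] Q := (normToInvariants B).lTensor A
  let j : P ⊗[k] Q →ₗ[k] A ⊗[k] Q := P.subtype.rTensor Q
  have hj : Function.Injective j :=
    Module.Flat.rTensor_preserves_injective_linearMap _ P.subtype_injective
  let i₀ : P ⊗[k] Q →ₗ[k] A ⊗[k] B := TensorProduct.map P.subtype Q.subtype
  have hi₀ : ∀ w, i₀ w ∈ M.ρ.invariants := by
    intro w
    induction w with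
    | zero => simp
    | add x y hx hy => rw [map_add]; exact add_mem hx hy
    | tmul x y =>
      intro g
      change (A.ρ (p g) x : A) ⊗ₜ[k] (B.ρ (q g) y : B) = _
      rw [x.2, y.2]
      rfl
  let i : P ⊗[k] Q →ₗ[k] M.ρ.invariants := i₀.codRestrict _ hi₀
  have hex : Function.Exact (N₁.rTensor Q) (π.rTensor Q) := by
    refine rTensor_exact Q (fun x => (hπ0 x).trans ?_) hπ
    exact ⟨fun ⟨m, hm⟩ => ⟨m, Subtype.ext hm⟩, fun ⟨m, hm⟩ => ⟨m, congrArg Subtype.val hm⟩⟩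
  have hsurj : Function.Surjective (π.rTensor Q) := LinearMap.rTensor_surjective Q hπ
  have hri : ∀ w, r (i₀ w) = b • j w := by
    intro w
    have : r ∘ₗ i₀ = b • j := TensorProduct.ext' fun x y => by
      change (x : A) ⊗ₜ[k] normToInvariants B y = b • ((x : A) ⊗ₜ[k] y)
      rw [← TensorProduct.tmul_smul]
      congr 1
      exact Subtype.ext (norm_apply_of_mem_invariants B y)
    exact LinearMap.congr_fun this w
  have hrN : ∀ s, r (M.ρ.norm s) = j (N₁.rTensor Q (b • r s)) := by
    intro s
    have : r ∘ₗ TensorProduct.map A.ρ.norm B.ρ.norm = j ∘ₗ N₁.rTensor Q ∘ₗ (b • r) :=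
      TensorProduct.ext' fun x y => by
        change A.ρ.norm x ⊗ₜ[k] normToInvariants B (B.ρ.norm y) =
          j (N₁.rTensor Q (b • (x ⊗ₜ[k] normToInvariants B y)))
        rw [← TensorProduct.tmul_smul]
        change _ = A.ρ.norm x ⊗ₜ[k] (b • normToInvariants B y)
        congr 1
        exact Subtype.ext (norm_apply_of_mem_invariants B (normToInvariants B y))
    rw [norm_tensorRes hpq]
    exact LinearMap.congr_fun this s
  -- `τ ∘ i` need not kill norms from `A`, but `b` times it does: the norm of `K` is `b` on `Q`.
  -- This is one factor of `b²`.
  have hle : LinearMap.ker (π.rTensor Q) ≤ LinearMap.ker (b • (τ ∘ₗ i)) := by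
    intro w hw
    obtain ⟨s, rfl⟩ := (hex w).1 hw
    rw [LinearMap.mem_ker, LinearMap.smul_apply, LinearMap.comp_apply, ← map_smul, ← map_smul,
      hτ0]
    refine ⟨Q.subtype.lTensor A s, ?_⟩
    have : TensorProduct.map A.ρ.norm B.ρ.norm ∘ₗ Q.subtype.lTensor A =
        b • (i₀ ∘ₗ N₁.rTensor Q) := TensorProduct.ext' fun x y => by
      change A.ρ.norm x ⊗ₜ[k] B.ρ.norm (y : B) = b • (A.ρ.norm x ⊗ₜ[k] (y : B))
      rw [norm_apply_of_mem_invariants, TensorProduct.tmul_smul]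
    rw [norm_tensorRes hpq, map_smul]
    exact LinearMap.congr_fun this s
  let F := (LinearMap.ker (π.rTensor Q)).liftQ _ hle ∘ₗ
    ((π.rTensor Q).quotKerEquivOfSurjective hsurj).symm.toLinearMap
  have hF : ∀ w, F (π.rTensor Q w) = b • τ (i w) := by
    intro w
    have : ((π.rTensor Q).quotKerEquivOfSurjective hsurj).symm (π.rTensor Q w) =
        Submodule.Quotient.mk w := by
      rw [LinearEquiv.symm_apply_eq]; rfl
    simp only [F, LinearMap.comp_apply, LinearEquiv.coe_coe, this]
    rfl
  refine ⟨F, fun y hy => ?_, fun z => ?_⟩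
  · obtain ⟨w, rfl⟩ := hsurj y
    rw [hF, ← map_smul, hτ0] at hy
    obtain ⟨s, hs⟩ := hy
    rw [← map_smul, hex]
    refine ⟨b • r s, hj ?_⟩
    rw [← hrN, hs]
    change r (b • i₀ w) = _
    rw [map_smul, hri, smul_smul, ← pow_two, map_smul]
  · obtain ⟨t, rfl⟩ := hτ z
    obtain ⟨w, hw⟩ := A.ρ.mem_range_rTensor_invariants Q (r t) fun h => by
      conv_rhs => rw [← rTensor_eq_of_mem_invariants hpq.2 A B t.2 h]
      exact LinearMap.congr_fun ((LinearMap.rTensor_comp_lTensor ..).trans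
        (LinearMap.lTensor_comp_rTensor ..).symm) (t : A ⊗[k] B)
    refine ⟨π.rTensor Q w, ?_⟩
    -- The norm of `K` multiplies the `G`-invariant `t` by `b`, the other factor of `b²`.
    have hiw : i w = b • t := by
      apply Subtype.ext
      have h1 : i₀ w = Q.subtype.lTensor A (r t) := by
        rw [← hw]
        exact LinearMap.congr_fun (LinearMap.lTensor_comp_rTensor ..).symm w
      have h2 : Q.subtype.lTensor A ∘ₗ r = ∑ h, (B.ρ h).lTensor A :=
        TensorProduct.ext' fun x y => by
          change x ⊗ₜ[k] B.ρ.norm y = _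
          simp [Representation.norm, LinearMap.sum_apply, TensorProduct.tmul_sum]
      refine h1.trans ((LinearMap.congr_fun h2 _).trans ?_)
      rw [LinearMap.sum_apply, Finset.sum_congr rfl fun h _ =>
        lTensor_eq_of_mem_invariants hpq.2 A B t.2 h]
      simp [b, Nat.cast_smul_eq_nsmul]
    rw [hF, hiw, map_smul, smul_smul, ← pow_two]

end TateCohomology

/-! ### Dimension shifting and the decomposition -/

namespace TateCohomology

variable {k G H K : Type u} [CommRing k] [Group G] [Group H] [Group K]
  [Fintype G] [Fintype H] [Fintype K]

open Rep

theorem nonempty_torsionBy_equiv_succ {p : G →* H} {q : G →* K}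
    (hpq : Function.Bijective (p.prod q)) (hHK : IsCoprime (Fintype.card H : k) (Fintype.card K))
    {A A' : Rep.{u} k H} (C : Rep.{u} k H) (f : A ⟶ funRep C) (g : funRep C ⟶ A')
    (hf : Function.Injective f.hom) (hfg : Function.Exact f.hom g.hom)
    (hg : Function.Surjective g.hom) (B : Rep.{u} k K) [Module.Flat k B] (n : ℤ) :
    Nonempty (
      Submodule.torsionBy k (tateCohomology (tensorRes p q A' B) n) (Fintype.card H : k) ≃ₗ[k]
      Submodule.torsionBy k (tateCohomology (tensorRes p q A B) (n + 1)) (Fintype.card H : k)) := by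
  obtain ⟨δ, h1, h2⟩ := exists_linearMap_succ (tensorResMap p q f B) (tensorResMap p q g B)
    (Module.Flat.rTensor_preserves_injective_linearMap f.hom.toLinearMap hf)
    (rTensor_exact (f := f.hom.toLinearMap) (g := g.hom.toLinearMap) B hfg hg)
    (LinearMap.rTensor_surjective (g := g.hom.toLinearMap) B hg) _
    (card_smul_eq_zero_tensorRes_funRep hpq C B) n
  refine Submodule.nonempty_torsionBy_equiv hHK δ (fun y => ?_) h1 h2
  rw [← Nat.cast_mul, ← Fintype.card_prod, ← Fintype.card_of_bijective hpq]
  exact card_smul_eq_zero _ _ y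

/-- Both sides shift along the same sequences. `A` varies in the induction, so only `B` and its
invariants are assumed flat. -/
theorem nonempty_torsionBy_equiv_tensor {p : G →* H} {q : G →* K}
    (hpq : Function.Bijective (p.prod q)) (hHK : IsCoprime (Fintype.card H : k) (Fintype.card K))
    (B : Rep.{u} k K) [Module.Flat k B] [Module.Flat k B.ρ.invariants] (n : ℤ)
    (A : Rep.{u} k H) :
    Nonempty (
      Submodule.torsionBy k (tateCohomology (tensorRes p q A B) n) (Fintype.card H : k) ≃ₗ[k]
      tateCohomology A n ⊗[k] B.ρ.invariants) := by
  induction n using Int.induction_on generalizing A with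
  | zero =>
    obtain ⟨F, h1, h2⟩ := exists_linearMap_tensor_zero hpq A B
    have hY : ∀ y : tateCohomology A 0 ⊗[k] B.ρ.invariants, (Fintype.card H : k) • y = 0 := by
      intro y
      induction y with
      | zero => simp
      | add x y hx hy => rw [smul_add, hx, hy, add_zero]
      | tmul x y => rw [TensorProduct.smul_tmul', card_smul_eq_zero, TensorProduct.zero_tmul]
    obtain ⟨e⟩ := Submodule.nonempty_torsionBy_equiv hHK.pow_right F
      (fun y => by rw [mul_comm, mul_smul, hY, smul_zero]) h1 h2
    refine ⟨e.symm.trans (LinearEquiv.ofTop _ ?_)⟩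
    exact eq_top_iff.2 fun y _ => (Submodule.mem_torsionBy_iff _ _).2 (hY y)
  | succ n ih =>
    have := mono_funRepConst A
    obtain ⟨hf, hfg, hg⟩ := function_exact_of_shortExact
      (S := ShortComplex.mk _ _ (cokernel.condition (funRepConst A)))
      { exact := ShortComplex.exact_cokernel _ }
    obtain ⟨e⟩ := nonempty_torsionBy_equiv_succ hpq hHK A _ _ hf hfg hg B n
    obtain ⟨e'⟩ := ih (cokernel (funRepConst A))
    obtain ⟨e''⟩ := nonempty_equiv_succ _ _ hf hfg hg (eq_zero_funRep A) n
    exact ⟨e.symm.trans (e'.trans (e''.rTensor _))⟩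
  | pred n ih =>
    have := epi_funRepSum A
    obtain ⟨hf, hfg, hg⟩ := function_exact_of_shortExact
      (S := ShortComplex.mk _ _ (kernel.condition (funRepSum A)))
      { exact := ShortComplex.exact_kernel _ }
    obtain ⟨e⟩ := nonempty_torsionBy_equiv_succ hpq hHK A _ _ hf hfg hg B (-n - 1)
    obtain ⟨e'⟩ := ih (kernel (funRepSum A))
    obtain ⟨e''⟩ := nonempty_equiv_succ _ _ hf hfg hg (eq_zero_funRep A) (-n - 1)
    rw [sub_add_cancel] at e e''
    exact ⟨e.trans (e'.trans (e''.symm.rTensor _))⟩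

/-- Exchanging the two factors of `tensorRes`. -/
noncomputable def _root_.Rep.tensorResComm (p : G →* H) (q : G →* K) (A : Rep.{u} k H)
    (B : Rep.{u} k K) : tensorRes p q A B ≅ tensorRes q p B A :=
  Rep.mkIso (Representation.Equiv.mk (TensorProduct.comm k A B) fun _ =>
    TensorProduct.ext' fun _ _ => rfl)

theorem nonempty_equiv_prod {p : G →* H} {q : G →* K}
    (hpq : Function.Bijective (p.prod q)) (hHK : IsCoprime (Fintype.card H : k) (Fintype.card K))
    (A : Rep.{u} k H) (B : Rep.{u} k K) [Module.Flat k A] [Module.Flat k A.ρ.invariants]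
    [Module.Flat k B] [Module.Flat k B.ρ.invariants] (n : ℤ) :
    Nonempty (tateCohomology (tensorRes p q A B) n ≃ₗ[k]
      (tateCohomology A n ⊗[k] B.ρ.invariants) × (A.ρ.invariants ⊗[k] tateCohomology B n)) := by
  let T := tateCohomology (tensorRes p q A B) n
  have hT : ∀ z : T, ((Fintype.card H : k) * Fintype.card K) • z = 0 := fun z => by
    rw [← Nat.cast_mul, ← Fintype.card_prod, ← Fintype.card_of_bijective hpq]
    exact card_smul_eq_zero _ _ z
  obtain ⟨e₁⟩ := nonempty_torsionBy_equiv_tensor hpq hHK B n A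
  -- General `p`, `q` in place of projections let the same lemma serve with the factors exchanged.
  have hqp : Function.Bijective (q.prod p) := (Equiv.prodComm H K).bijective.comp hpq
  obtain ⟨e₂⟩ := nonempty_torsionBy_equiv_tensor hqp hHK.symm A n B
  let c : T ≃ₗ[k] tateCohomology (tensorRes q p B A) n :=
    ((tateCohomologyFunctor n).mapIso (tensorResComm p q A B)).toLinearEquiv
  obtain ⟨e₃⟩ := Submodule.nonempty_torsionBy_equiv hHK.symm c.toLinearMap
    (fun z => by rw [mul_comm]; exact hT z)
    (fun z hz => by rw [c.map_eq_zero_iff.1 hz, smul_zero])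
    (fun z => ⟨c.symm ((Fintype.card H : k) • z), c.apply_symm_apply _⟩)
  have hc : IsCompl (Submodule.torsionBy k T (Fintype.card H : k))
      (Submodule.torsionBy k T (Fintype.card K : k)) := by
    obtain ⟨u, v, huv⟩ := hHK
    constructor
    · rw [Submodule.disjoint_def]
      intro z hz hz'
      rw [Submodule.mem_torsionBy_iff] at hz hz'
      rw [← one_smul k z, ← huv, add_smul, mul_smul, mul_smul, hz, hz', smul_zero, smul_zero,
        add_zero]
    · rw [codisjoint_iff, eq_top_iff]
      intro z _
      rw [← one_smul k z, ← huv, add_smul, add_comm]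
      refine Submodule.add_mem_sup ?_ ?_ <;> rw [Submodule.mem_torsionBy_iff, smul_smul]
      · rw [mul_left_comm, mul_smul, hT, smul_zero]
      · rw [mul_left_comm, mul_comm (Fintype.card K : k), mul_smul, hT, smul_zero]
  exact ⟨(Submodule.prodEquivOfIsCompl _ _ hc).symm.trans
    (e₁.prodCongr (e₃.trans (e₂.trans (TensorProduct.comm ..))))⟩

end TateCohomology

theorem corollary3p4 {G₁ G₂ : Type} [Group G₁] [Group G₂] [Fintype G₁] [Fintype G₂]
    (hG : Nat.Coprime (Fintype.card G₁) (Fintype.card G₂))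
    (M₁ : Rep.{0} ℤ G₁) (M₂ : Rep.{0} ℤ G₂) (hM₁ : IsGLattice M₁) (hM₂ : IsGLattice M₂)
    (n : ℤ) :
    Nonempty (tateCohomology (externalTensor M₁ M₂) n ≅
      (tateCohomology M₁ n ⊗ invariantsModule M₂) ⊞
        (invariantsModule M₁ ⊗ tateCohomology M₂ n)) := by
  -- Over `ℤ` these make the lattices and their invariants flat, by instance search.
  have := hM₁.free
  have := hM₁.finite
  have := hM₂.free
  have := hM₂.finite
  obtain ⟨e⟩ := TateCohomology.nonempty_equiv_prod (p := MonoidHom.fst G₁ G₂)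
    (q := MonoidHom.snd G₁ G₂) Function.bijective_id hG.isCoprime M₁ M₂ n
  let b := (ModuleCat.biprodIsoProd (tateCohomology M₁ n ⊗ invariantsModule M₂)
    (invariantsModule M₁ ⊗ tateCohomology M₂ n)).toLinearEquiv
  exact ⟨(e.trans b.symm).toModuleIso⟩
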